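/- **Setting.** Let $k$ be a field, $X$ a smooth $k$-scheme and $\mathbf D=(D_i)_{i\in I}$ a finite family of distinct integral effective Cartier divisors on $X$ such that $D=\bigcup_i D_i=\sum_i D_i$ is a strict normal crossings divisor. Let $\mathbf r=(r_i)_{i\in I}$ be positive integers invertible in $k$ such that, for each $i$, the elements $0,\frac1{r_i},\dots,\frac{r_i-1}{r_i}$ of $k$ are pairwise distinct (i.e. $k$ has characteristic $0$ or characteristic $>r_i$). Write $(e_i)$ for the canonical basis of $\mathbb Z^I$ and $\frac{\mathbf l}{\mathbf r}=(l_i/r_i)_{i}$ for $\mathbf l\in\mathbb Z^I$; order $\frac1{\mathbf r}\mathbb Z^I=\prod_i\frac1{r_i}\mathbb Z$ componentwise. The sheaf $\Omega^1_{X/k}(\log D)$ is generated by $\Omega^1_{X/k}$ and symbols $\operatorname{dlog}f$, for $f$ a local equation of one of the $D_i$, with $f\operatorname{dlog}f=df$ and $\operatorname{dlog}(uf)=\operatorname{dlog}f+u^{-1}du$ for units $u$. Its residue map to $\mathcal O_{D_i}$ kills $\Omega^1_{X/k}$ and sends $\operatorname{dlog}f$ to $1$ if $f$ is an equation of $D_i$,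 and to $0$ if it is an equation of $D_j$, $j\ne i$. A logarithmic connection on a vector bundle $\mathcal E$ is a $k$-linear morphism $\nabla:\mathcal E\to\mathcal E\otimes\Omega^1_{X/k}(\log D)$ satisfying the Leibniz rule; it induces an $\mathcal O_{D_i}$-linear residue $\operatorname{res}_{D_i}\nabla\in\operatorname{End}(\mathcal E|_{D_i})$. A parabolic connection $(\mathcal E_\cdot,\nabla_\cdot)$ on $(X,\mathbf D)$ with weights in $\frac1{\mathbf r}\mathbb Z^I$ is a functor from $(\frac1{\mathbf r}\mathbb Z^I)^{op}$ to vector bundles with logarithmic connection on $X$ (with horizontal morphisms), together with isomorphisms of vector bundles $\mathcal E_{\alpha+\mathbf l}\simeq\mathcal E_\alpha\otimes\mathcal O_X(-\sum_i l_iD_i)$ for all $\mathbf l\in\mathbb Z^I$, natural in $\alpha$, such that for $\mathbf l\ge 0$ the composite $\mathcal E_{\alpha+\mathbf l}\simeq\mathcal E_\alpha(-\sum_i l_iD_i)\hookrightarrow\mathcal E_\alpha$ is the transition morphism. It is strongly parabolic if, for all $i\in I$ and $\mathbf l\in\mathbb Z^I$, the endomorphism of $\mathcal E_{\mathbf l/\mathbf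 r}/\mathcal E_{(\mathbf l+e_i)/\mathbf r}$ induced by $\operatorname{res}_{D_i}(\nabla_{\mathbf l/\mathbf r})$ is $\frac{l_i}{r_i}\mathrm{id}$. **Proposition.** Let $(\mathcal E_\cdot,\nabla_\cdot)$ be a strongly parabolic connection on $(X,\mathbf D)$ with weights in $\frac1{\mathbf r}\mathbb Z^I$. 1. The residues of $(\mathcal E_0,\nabla_0)$ are semisimple with eigenvalues in $\frac1{r_i}\mathbb Z\cap[0,1)$: for each $i\in I$, $$\mathcal E_0|_{D_i}=\bigoplus_{m=0}^{r_i-1}\mathcal E_0|_{D_i}\left(\tfrac m{r_i}\right),\qquad \mathcal E_0|_{D_i}(c)=\ker\left(\operatorname{res}_{D_i}\nabla_0-c\right).$$ 2. The filtration of $\mathcal E_0|_D$ attached to $\nabla_0$ coincides with the weight filtration: for every $\mathbf l\in\mathbb Z^I$ with $0\le l_i\le r_i$ for all $i$, $$\frac{\mathcal E_{\mathbf l/\mathbf r}}{\mathcal E_0(-D)}=\bigcap_{i\in I}\pi_i^{-1}\left(\bigoplus_{l_i\le m<r_i}\mathcal E_0|_{D_i}\left(\tfrac m{r_i}\right)\right)\subset\mathcal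 E_0|_D,$$ where $\pi_i:\mathcal E_0|_D\to\mathcal E_0|_{D_i}$ is the canonical surjection. -/

import Mathlib

open CategoryTheory AlgebraicGeometry TopologicalSpace Opposite
open scoped TensorProduct AlgebraicGeometry KaehlerDifferential

universe u

noncomputable section

namespace ParConn

/-! ### Logarithmic differentials of a ring along a family of principal ideals -/

section Algebra

variable (k : Type*) {A : Type*} [CommRing k] [CommRing A] [Algebra k A]
variable {I : Type*} (J : I → Ideal A)

/-- A local equation of one of the divisors: an index `i` with a generator `f` of `J i`. -/
abbrev LocalEquation : Type _ := Σ i : I, {f : A // J i = Ideal.span {f}}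

/-- The relations `f • dlog f = d f` for every local equation `f` of `J i`, and
`u • dlog (u f) = u • dlog f + d u` for every unit `u`. -/
def logRelations : Submodule A (Ω[A⁄k] × (LocalEquation J →₀ A)) :=
  Submodule.span A
    ({z | ∃ g : LocalEquation J,
        z = (KaehlerDifferential.D k A g.2.1, -Finsupp.single g g.2.1)} ∪
     {z | ∃ (i : I) (f f' : {f : A // J i = Ideal.span {f}}) (v : Aˣ), f'.1 = v * f.1 ∧
        z = (KaehlerDifferential.D k A (v : A),
          Finsupp.single (⟨i, f⟩ : LocalEquation J) (v : A) -
            Finsupp.single (⟨i, f'⟩ : LocalEquation J) (v : A))})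

/-- The module of logarithmic differentials of `A` over `k` along the principal ideals `J i`:
it is generated by `Ω[A⁄k]` and symbols `dlog f`, one for each generator `f` of each `J i`, with
`f • dlog f = d f` and `dlog (u f) = dlog f + u⁻¹ • d u` for units `u`.
If `J i = (f i)`, it is the quotient of `Ω[A⁄k] ⊕ ⨁ i, A • dlog (f i)` by the relations
`f i • dlog (f i) = d (f i)`. -/
abbrev LogDifferentials : Type _ :=
  (Ω[A⁄k] × (LocalEquation J →₀ A)) ⧸ logRelations k J

namespace LogDifferentials

/-- The map from differentials to logarithmic differentials. -/
def ofKaehler : Ω[A⁄k] →ₗ[A] LogDifferentials k J :=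
  (logRelations k J).mkQ ∘ₗ LinearMap.inl A _ _

/-- The universal derivation, with values in the logarithmic differentials. -/
def d (a : A) : LogDifferentials k J := ofKaehler k J (KaehlerDifferential.D k A a)

/-- The logarithmic differential of a local equation. -/
def dlog (g : LocalEquation J) : LogDifferentials k J :=
  (logRelations k J).mkQ (0, Finsupp.single g 1)

variable {J} in
/-- Two linear maps given on `Ω[A⁄k]` and on the symbols `dlog f`, compatible with the relations,
define a linear map on the logarithmic differentials. -/
def lift {N : Type*} [AddCommGroup N] [Module A N] (α : Ω[A⁄k] →ₗ[A] N)
    (β : LocalEquation J → N)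
    (h₁ : ∀ g : LocalEquation J, α (KaehlerDifferential.D k A g.2.1) = g.2.1 • β g)
    (h₂ : ∀ (i : I) (f f' : {f : A // J i = Ideal.span {f}}) (v : Aˣ), f'.1 = v * f.1 →
      α (KaehlerDifferential.D k A (v : A)) + (v : A) • β ⟨i, f⟩ = (v : A) • β ⟨i, f'⟩) :
    LogDifferentials k J →ₗ[A] N :=
  (logRelations k J).liftQ (LinearMap.coprod α (Finsupp.linearCombination A β)) (by
    rw [logRelations, Submodule.span_le]
    rintro z (⟨g, rfl⟩ | ⟨i, f, f', v, hv, rfl⟩)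
    · simp [h₁ g]
    · have := h₂ i f f' v hv
      simp only [SetLike.mem_coe, LinearMap.mem_ker, LinearMap.coprod_apply, map_sub,
        Finsupp.linearCombination_single]
      rw [← this]
      abel)

@[simp]
lemma lift_d {N : Type*} [AddCommGroup N] [Module A N] (α : Ω[A⁄k] →ₗ[A] N)
    (β : LocalEquation J → N) (h₁) (h₂) (a : A) :
    lift k α β h₁ h₂ (d k J a) = α (KaehlerDifferential.D k A a) := by
  simp [lift, d, ofKaehler]

@[simp]
lemma lift_dlog {N : Type*} [AddCommGroup N] [Module A N] (α : Ω[A⁄k] →ₗ[A] N)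
    (β : LocalEquation J → N) (h₁) (h₂) (g : LocalEquation J) :
    lift k α β h₁ h₂ (dlog k J g) = β g := by
  simp [lift, dlog]

lemma smul_dlog (g : LocalEquation J) : g.2.1 • dlog k J g = d k J g.2.1 := by
  rw [← sub_eq_zero, ← neg_eq_zero]
  simp only [dlog, d, ofKaehler, LinearMap.comp_apply, ← map_smul, ← map_sub, ← map_neg]
  rw [Submodule.mkQ_apply, Submodule.Quotient.mk_eq_zero]
  refine Submodule.subset_span (Or.inl ⟨g, ?_⟩)
  ext <;> simp

lemma smul_dlog_unit (i : I) (f f' : {f : A // J i = Ideal.span {f}}) (v : Aˣ)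
    (hv : f'.1 = v * f.1) :
    d k J (v : A) + (v : A) • dlog k J ⟨i, f⟩ = (v : A) • dlog k J ⟨i, f'⟩ := by
  rw [← sub_eq_zero]
  simp only [dlog, d, ofKaehler, LinearMap.comp_apply, ← map_smul, ← map_sub, ← map_add]
  rw [Submodule.mkQ_apply, Submodule.Quotient.mk_eq_zero]
  refine Submodule.subset_span (Or.inr ⟨i, f, f', v, hv, ?_⟩)
  ext <;> simp

open Classical in
/-- The residue along `J i`: it kills `d a`, sends `dlog f` to `1` if `f` is an equation
of `J i`, and to `0` if `f` is an equation of `J j` with `j ≠ i`. -/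
def res (i : I) : LogDifferentials k J →ₗ[A] A ⧸ J i :=
  lift k 0 (fun g => if g.1 = i then 1 else 0)
    (by
      rintro ⟨j, f, hf⟩
      by_cases h : j = i
      · subst h
        have : f ∈ J j := hf ▸ Ideal.mem_span_singleton_self f
        simp [Algebra.smul_def, Ideal.Quotient.eq_zero_iff_mem.mpr this]
      · simp [h])
    (by intros; simp)

lemma span_localEquation {B : Type*} [CommRing B] [Algebra A B] (J' : I → Ideal B)
    (h : ∀ i, J' i = (J i).map (algebraMap A B)) (i : I) {f : A} (hf : J i = Ideal.span {f}) :
    J' i = Ideal.span {algebraMap A B f} := by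
  rw [h, hf, Ideal.map_span, Set.image_singleton]

/-- Functoriality: a map `A → B` of `k`-algebras with `J' i = J i • B` induces a map on
logarithmic differentials, with `d a ↦ d a` and `dlog f ↦ dlog f`. -/
def map {B : Type*} [CommRing B] [Algebra k B] [Algebra A B] [IsScalarTower k A B]
    (J' : I → Ideal B) (h : ∀ i, J' i = (J i).map (algebraMap A B)) :
    LogDifferentials k J →ₗ[A] LogDifferentials k J' :=
  lift k ((ofKaehler k J').restrictScalars A ∘ₗ KaehlerDifferential.map k k A B)
    (fun g => dlog k J' ⟨g.1, algebraMap A B g.2.1, span_localEquation J J' h g.1 g.2.2⟩)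
    (by
      rintro ⟨i, f, hf⟩
      have := smul_dlog k J' ⟨i, algebraMap A B f, span_localEquation J J' h i hf⟩
      simpa [d] using this.symm)
    (by
      intro i f f' v hv
      have := smul_dlog_unit k J' i
        ⟨algebraMap A B f.1, span_localEquation J J' h i f.2⟩
        ⟨algebraMap A B f'.1, span_localEquation J J' h i f'.2⟩
        (Units.map (algebraMap A B).toMonoidHom v) (by simp [hv])
      simpa [d] using this)

end LogDifferentials

/-! ### Logarithmic connections on a module, and their residues -/

/-- A logarithmic connection on an `A`-module `M`: an additive map `M → M ⊗ Ω(log)` satisfying the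
Leibniz rule. It is automatically `k`-linear (`ModuleLogConnection.map_smul_base`). -/
structure ModuleLogConnection (M : Type*) [AddCommGroup M] [Module A M] where
  /-- The underlying additive map. -/
  nabla : M →+ M ⊗[A] LogDifferentials k J
  leibniz : ∀ (a : A) (m : M), nabla (a • m) = a • nabla m + m ⊗ₜ LogDifferentials.d k J a

namespace ModuleLogConnection

variable {k J} {M : Type*} [AddCommGroup M] [Module A M] (D : ModuleLogConnection k J M)

lemma map_smul_base (c : k) (m : M) :
    D.nabla (algebraMap k A c • m) = algebraMap k A c • D.nabla m := by
  simp [D.leibniz, LogDifferentials.d]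

/-- The composite `M → M ⊗ Ω(log) → M ⊗ A/J i = M / J i M`; it is linear over `A`. -/
def preResidue (i : I) : M →ₗ[A] M ⧸ (J i • ⊤ : Submodule A M) where
  toFun m := TensorProduct.tensorQuotEquivQuotSMul M (J i)
    ((LogDifferentials.res k J i).lTensor M (D.nabla m))
  map_add' := by simp
  map_smul' a m := by
    have h : LogDifferentials.res k J i (LogDifferentials.d k J a) = 0 := by
      simp [LogDifferentials.res]
    simp [D.leibniz, h]

lemma smul_top_le_ker (i : I) :
    (J i • ⊤ : Submodule A M) ≤ LinearMap.ker (D.preResidue i) := by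
  rw [Submodule.smul_le]
  intro a ha m _
  rw [LinearMap.mem_ker, map_smul]
  obtain ⟨n, hn⟩ := Submodule.mkQ_surjective _ (D.preResidue i m)
  rw [← hn, ← map_smul, Submodule.mkQ_apply, Submodule.Quotient.mk_eq_zero]
  exact Submodule.smul_mem_smul ha trivial

/-- The residue along `J i`, an endomorphism of `M / J i M`. -/
def residue (i : I) : Module.End A (M ⧸ (J i • ⊤ : Submodule A M)) :=
  (J i • ⊤ : Submodule A M).liftQ (D.preResidue i) (D.smul_top_le_ker i)

end ModuleLogConnection

end Algebra

/-! ### Schemes: divisors and vector bundles -/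

section Geometry

variable {X : Scheme.{u}}

/-- The closed subscheme with ideal sheaf `D` is an effective Cartier divisor: its ideal is locally
generated by a nonzerodivisor. -/
def IsEffectiveCartier (D : X.IdealSheafData) : Prop :=
  ∀ x : X, ∃ U : X.affineOpens, x ∈ U.1 ∧
    ∃ f ∈ nonZeroDivisors Γ(X, U.1), D.ideal U = Ideal.span {f}

/-- Strict normal crossings: at each point `x` of the divisor the local ring is regular and has a
regular system of parameters `t 0, …, t (n - 1)` such that the divisor has equation
`t 0 * ⋯ * t (m - 1)` at `x` for some `1 ≤ m ≤ n`. -/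
def IsStrictNormalCrossings (D : X.IdealSheafData) : Prop :=
  ∀ x ∈ D.support, IsRegularLocalRing (X.presheaf.stalk x) ∧
    ∃ (n : ℕ) (t : Fin n → X.presheaf.stalk x) (m : ℕ),
      ringKrullDim (X.presheaf.stalk x) = n ∧
      Ideal.span (Set.range t) = IsLocalRing.maximalIdeal (X.presheaf.stalk x) ∧
      1 ≤ m ∧ m ≤ n ∧
      ∀ (U : X.affineOpens) (hx : x ∈ U.1),
        (D.ideal U).map (X.presheaf.germ U.1 x hx).hom =
          Ideal.span {∏ j : Fin n with j.1 < m, t j}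

/-- A vector bundle: a sheaf of modules which is locally free of finite rank. -/
def IsVectorBundle (E : X.Modules) : Prop :=
  ∃ q : SheafOfModules.LocalGeneratorsData.{u} (R := X.ringCatSheaf) E,
    q.IsLocallyFreeData ∧ q.IsFiniteType

/-- A morphism of sheaves of modules on sections over `U`, as a linear map. -/
def appLinear {E F : X.Modules} (φ : E ⟶ F) (U : X.Opens) : Γ(E, U) →ₗ[Γ(X, U)] Γ(F, U) where
  toFun := φ.app U
  map_add' := map_add _
  map_smul' r x := Scheme.Modules.Hom.app_smul φ r x

/-- The restriction of sections of a sheaf of modules. -/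
def resM (E : X.Modules) {V U : X.Opens} (h : V ≤ U) : Γ(E, U) →+ Γ(E, V) :=
  (E.presheaf.map (homOfLE h).op).hom

lemma resM_smul (E : X.Modules) {V U : X.Opens} (h : V ≤ U) (a : Γ(X, U)) (s : Γ(E, U)) :
    resM E h (a • s) = (X.presheaf.map (homOfLE h).op).hom a • resM E h s :=
  E.map_smul (homOfLE h) a s

variable {I : Type*}

/-- The smooth `k`-scheme `X` with the family of divisors `D i` given by the ideal sheaves `J i`,
in the log-smooth context: the `D i` are distinct integral effective Cartier divisors, and their
union is a strict normal crossings divisor. -/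
structure IsLogSmooth (k : Type u) [Field k] (X : Scheme.{u}) [X.Over (Spec (.of k))]
    {I : Type*} [Fintype I] (J : I → X.IdealSheafData) : Prop where
  smooth : Smooth (X ↘ Spec (.of k))
  cartier : ∀ i, IsEffectiveCartier (J i)
  integral : ∀ i, IsIntegral (J i).subscheme
  distinct : Function.Injective J
  snc : IsStrictNormalCrossings (∏ i, J i)

/-- The ideal sheaf `𝒪(-∑ᵢ lᵢ⁺ Dᵢ)`, where `lᵢ⁺ = max lᵢ 0`. -/
def divisorIdeal [Fintype I] (J : I → X.IdealSheafData) (l : I → ℤ) : X.IdealSheafData :=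
  ∏ i, J i ^ (l i).toNat

/-! ### Logarithmic connections on a vector bundle -/

/-- The `k`-algebra structure on the sections of a `k`-scheme. -/
instance sectionsAlgebra (k : Type u) [Field k] [X.Over (Spec (.of k))] (U : X.Opens) :
    Algebra k Γ(X, U) :=
  ((Scheme.ΓSpecIso (.of k)).inv ≫ (X ↘ Spec (.of k)).appLE ⊤ U le_top).hom.toAlgebra

lemma map_algebraMap (k : Type u) [Field k] [X.Over (Spec (.of k))] {V U : X.Opens}
    (h : V ≤ U) (c : k) :
    (X.presheaf.map (homOfLE h).op).hom (algebraMap k Γ(X, U) c) = algebraMap k Γ(X, V) c := by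
  have : (X ↘ Spec (.of k)).appLE ⊤ U le_top ≫ X.presheaf.map (homOfLE h).op =
      (X ↘ Spec (.of k)).appLE ⊤ V le_top :=
    Scheme.Hom.appLE_map _ _ _
  exact congr($(this).hom ((Scheme.ΓSpecIso (.of k)).inv.hom c))

/-- An affine open on which the ideal of each divisor is principal. If the `D i` are Cartier
divisors, these form a basis of the topology, stable under passing to smaller affine opens. -/
structure LogChart (J : I → X.IdealSheafData) where
  /-- The underlying affine open. -/
  U : X.affineOpens
  principal : ∀ i, ((J i).ideal U).IsPrincipal

namespace LogChart

variable {J : I → X.IdealSheafData}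

/-- The ring of sections on a chart. -/
abbrev ring (C : LogChart J) : Type u := Γ(X, C.U.1)

/-- The ideal of the divisor `D i` on a chart. -/
abbrev ideal (C : LogChart J) (i : I) : Ideal C.ring := (J i).ideal C.U

end LogChart

variable (k : Type u) [Field k] [X.Over (Spec (.of k))]

/-- The restriction map of the sheaf `E ⊗ Ω(log D)` between charts, where the sections of this
sheaf on a chart `C` are `Γ(E, C) ⊗ Ω(log D)(C)`. It sends `s ⊗ d a` to `s|_C' ⊗ d (a|_C')` and
`s ⊗ dlog f` to `s|_C' ⊗ dlog (f|_C')`. -/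
def resLog {J : I → X.IdealSheafData} (E : X.Modules) {C' C : LogChart J} (h : C'.U.1 ≤ C.U.1) :
    Γ(E, C.U.1) ⊗[C.ring] LogDifferentials k C.ideal →+
      Γ(E, C'.U.1) ⊗[C'.ring] LogDifferentials k C'.ideal :=
  letI : Algebra C.ring C'.ring := (X.presheaf.map (homOfLE h).op).hom.toAlgebra
  haveI : IsScalarTower k C.ring C'.ring :=
    IsScalarTower.of_algebraMap_eq fun c => (map_algebraMap k h c).symm
  letI : Module C.ring Γ(E, C'.U.1) := Module.compHom _ (algebraMap C.ring C'.ring)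
  haveI : IsScalarTower C.ring C'.ring Γ(E, C'.U.1) := IsScalarTower.of_algebraMap_smul
    fun _ _ => rfl
  letI ρ : Γ(E, C.U.1) →ₗ[C.ring] Γ(E, C'.U.1) :=
    { resM E h with map_smul' := fun a s => resM_smul E h a s }
  (TensorProduct.mapOfCompatibleSMul C'.ring C.ring C.ring Γ(E, C'.U.1)
      (LogDifferentials k C'.ideal) ∘ₗ
    TensorProduct.map ρ (LogDifferentials.map k C.ideal C'.ideal
      (fun i => ((J i).map_ideal (U := C'.U) (V := C.U) h).symm))).toAddMonoidHom

/-- A logarithmic connection `E → E ⊗ Ω(log D)` on a sheaf of modules (a vector bundle, in all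
uses): a morphism of sheaves satisfying the Leibniz rule, given on the basis of charts. -/
structure LogConnection (J : I → X.IdealSheafData) (E : X.Modules) where
  /-- The connection on the sections over a chart. -/
  conn (C : LogChart J) : ModuleLogConnection k C.ideal Γ(E, C.U.1)
  conn_res {C' C : LogChart J} (h : C'.U.1 ≤ C.U.1) (s : Γ(E, C.U.1)) :
    resLog k E h ((conn C).nabla s) = (conn C').nabla (resM E h s)

variable {k}

/-- A morphism of sheaves of modules is compatible with logarithmic connections. -/
def IsHorizontal {J : I → X.IdealSheafData} {E F : X.Modules}
    (D : LogConnection k J E) (D' : LogConnection k J F) (φ : E ⟶ F) : Prop :=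
  ∀ (C : LogChart J) (s : Γ(E, C.U.1)),
    (appLinear φ C.U.1).rTensor (LogDifferentials k C.ideal) ((D.conn C).nabla s) =
      (D'.conn C).nabla (appLinear φ C.U.1 s)

/-- The residue of a logarithmic connection along `D i`: an endomorphism of the restriction of `E`
to `D i`, given on each chart. -/
def LogConnection.residue {J : I → X.IdealSheafData} {E : X.Modules}
    (D : LogConnection k J E) (i : I) (C : LogChart J) :
    Module.End C.ring (Γ(E, C.U.1) ⧸ (C.ideal i • ⊤ : Submodule C.ring Γ(E, C.U.1))) :=
  (D.conn C).residue i

/-- The eigen-subsheaf for the eigenvalue `c : k` of the residue along `D i`, on a chart. -/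
def LogConnection.eigenSubsheaf {J : I → X.IdealSheafData} {E : X.Modules}
    (D : LogConnection k J E) (i : I) (C : LogChart J) (c : k) :
    Submodule C.ring (Γ(E, C.U.1) ⧸ (C.ideal i • ⊤ : Submodule C.ring Γ(E, C.U.1))) :=
  (D.residue i C).eigenspace (algebraMap k C.ring c)

/-! ### Parabolic bundles and parabolic connections -/

section Parabolic

/-- The index `a / r + l` of `∏ i, (1 / r i) ℤ`, where the index `a / r` is encoded by the integral
vector `a`, and `l` is an integral vector. -/
def shift (r : I → ℕ) (a l : I → ℤ) : I → ℤ := fun i => a i + r i * l i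

lemma shift_mono (r : I → ℕ) {a b : I → ℤ} (h : a ≤ b) (l : I → ℤ) :
    shift r a l ≤ shift r b l := fun i => by simpa [shift] using h i

lemma le_shift (r : I → ℕ) (a : I → ℤ) {l : I → ℤ} (h : 0 ≤ l) : a ≤ shift r a l := fun i => by
  have := mul_nonneg (Int.natCast_nonneg (r i)) (h i)
  simpa [shift] using this

lemma le_add_single [DecidableEq I] (l : I → ℤ) (i : I) : l ≤ l + Pi.single i 1 := by
  simp [Pi.single_nonneg]

/-- The transition morphism `E_b → E_a` for `a ≤ b`. -/
abbrev trans (E : (I → ℤ)ᵒᵖ ⥤ X.Modules) {a b : I → ℤ} (h : a ≤ b) :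
    E.obj (op b) ⟶ E.obj (op a) := E.map (Quiver.Hom.op fun i => homOfLE (h i))

variable [Fintype I]

/-- The sections on an affine open `U` of the twist `E(-∑ᵢ lᵢ⁺ Dᵢ)`, as a submodule of the
sections of the vector bundle `E`. -/
abbrev twist (J : I → X.IdealSheafData) (E : X.Modules) (l : I → ℤ) (U : X.affineOpens) :
    Submodule Γ(X, U.1) Γ(E, U.1) := (divisorIdeal J l).ideal U • ⊤

/-- A parabolic vector bundle on `(X, D)` with weights in `∏ i, (1 / r i) ℤ`, where the multi-index
`(l i / r i)ᵢ` is encoded by `l : I → ℤ`.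

For an integral multi-index `l`, write `l = l⁺ - l⁻`. The pseudo-periodicity isomorphism
`E_{a + l} ≃ E_a ⊗ 𝒪(-l • D)` is given after twisting by `𝒪(-l⁻ • D)`, in the form
`E_{a + l}(-l⁻ • D) ≃ E_a(-l⁺ • D)`, as an isomorphism of sheaves (`per`, `per_res`) which is
natural in `a` (`per_nat`). If `l ≥ 0`, then `E_{a + l} ≃ E_a(-l • D)`, followed by the inclusion
in `E_a`, is the transition morphism (`per_comp`). -/
structure ParabolicBundle (J : I → X.IdealSheafData) (r : I → ℕ) where
  /-- The functor. -/
  E : (I → ℤ)ᵒᵖ ⥤ X.Modules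
  isVectorBundle : ∀ a, IsVectorBundle (E.obj a)
  /-- The pseudo-periodicity isomorphisms. -/
  per (l a : I → ℤ) (U : X.affineOpens) :
    twist J (E.obj (op (shift r a l))) (-l) U ≃ₗ[Γ(X, U.1)] twist J (E.obj (op a)) l U
  per_res (l a : I → ℤ) {V U : X.affineOpens} (h : V.1 ≤ U.1)
    (x : twist J (E.obj (op (shift r a l))) (-l) U)
    (y : twist J (E.obj (op (shift r a l))) (-l) V) (hxy : resM _ h x.1 = y.1) :
    resM _ h (per l a U x).1 = (per l a V y).1
  per_nat (l : I → ℤ) {a b : I → ℤ} (h : a ≤ b) (U : X.affineOpens)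
    (x : twist J (E.obj (op (shift r b l))) (-l) U)
    (y : twist J (E.obj (op (shift r a l))) (-l) U)
    (hxy : appLinear (trans E (shift_mono r h l)) U.1 x.1 = y.1) :
    appLinear (trans E h) U.1 (per l b U x).1 = (per l a U y).1
  per_comp (l : I → ℤ) (hl : 0 ≤ l) (a : I → ℤ) (U : X.affineOpens)
    (x : twist J (E.obj (op (shift r a l))) (-l) U) :
    (per l a U x).1 = appLinear (trans E (le_shift r a hl)) U.1 x.1

variable (k) in
/-- A parabolic connection: a parabolic vector bundle whose underlying functor to vector bundles is
lifted to a functor to logarithmic connections. -/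
structure ParabolicConnection (J : I → X.IdealSheafData) (r : I → ℕ)
    extends ParabolicBundle J r where
  /-- The logarithmic connection on `E_a`. -/
  conn (a : I → ℤ) : LogConnection k J (E.obj (op a))
  horizontal {a b : I → ℤ} (h : a ≤ b) : IsHorizontal (conn b) (conn a) (trans E h)

variable {J : I → X.IdealSheafData} {r : I → ℕ}

/-- The image of `E_b` in `E_a / J • E_a` on an affine open, for `a ≤ b`. -/
def ParabolicBundle.imageIn (P : ParabolicBundle J r) {a b : I → ℤ} (h : a ≤ b)
    (U : X.affineOpens) (K : Ideal Γ(X, U.1)) :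
    Submodule Γ(X, U.1) (Γ(P.E.obj (op a), U.1) ⧸
      (K • ⊤ : Submodule Γ(X, U.1) Γ(P.E.obj (op a), U.1))) :=
  (LinearMap.range (appLinear (trans P.E h) U.1)).map (Submodule.mkQ _)

/-- A parabolic connection is strongly parabolic if, for each `l` and `i`, the residue of `∇_{l/r}`
along `D i` induces `(l i / r i) • id` on `E_{l/r} / E_{(l + e i)/r}`. Here `E_{l/r} / E_{(l + e i)/r}`
is written as the quotient of `E_{l/r}` restricted to `D i` by the image of `E_{(l + e i)/r}`. -/
def ParabolicConnection.IsStrong [DecidableEq I] (P : ParabolicConnection k J r) : Prop :=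
  ∀ (l : I → ℤ) (i : I) (C : LogChart J)
    (x : Γ(P.E.obj (op l), C.U.1) ⧸
      (C.ideal i • ⊤ : Submodule C.ring Γ(P.E.obj (op l), C.U.1))),
    (P.imageIn (le_add_single l i) C.U (C.ideal i)).mkQ ((P.conn l).residue i C x) =
      algebraMap k C.ring ((l i : k) / (r i : k)) •
        (P.imageIn (le_add_single l i) C.U (C.ideal i)).mkQ x

/-- The weight filtration on the restriction of `E_0` to `D = ∑ᵢ D i`, on an affine open:
`F^w_{l/r} = E_{l/r} / E_0(-D)`, for `0 ≤ l ≤ r`. -/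
def ParabolicBundle.weightFiltration (P : ParabolicBundle J r) {l : I → ℤ} (hl : 0 ≤ l)
    (U : X.affineOpens) :
    Submodule Γ(X, U.1) (Γ(P.E.obj (op 0), U.1) ⧸
      ((∏ i, J i).ideal U • ⊤ : Submodule Γ(X, U.1) Γ(P.E.obj (op 0), U.1))) :=
  P.imageIn hl U ((∏ i, J i).ideal U)

/-- The residues of a logarithmic connection are semisimple with eigenvalues `m / r i`,
`0 ≤ m < r i`: for each `i`, the restriction of `E` to `D i` is the direct sum of the
eigen-subsheaves of the residue along `D i` for these eigenvalues. -/
def LogConnection.HasSemisimpleResidues {E : X.Modules} (D : LogConnection k J E)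
    (r : I → ℕ) : Prop :=
  ∀ (i : I) (C : LogChart J),
    DirectSum.IsInternal (fun m : Fin (r i) => D.eigenSubsheaf i C ((m : ℕ) / (r i : k)))

lemma prod_ideal_le (J : I → X.IdealSheafData) (i : I) (U : X.affineOpens) :
    (∏ j, J j).ideal U ≤ (J i).ideal U := by
  classical
  rw [← Finset.mul_prod_erase _ J (Finset.mem_univ i), Scheme.IdealSheafData.ideal_mul]
  change (J i).ideal U * (∏ j ∈ Finset.univ.erase i, J j).ideal U ≤ (J i).ideal U
  exact Ideal.mul_le_inf.trans inf_le_left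

/-- The canonical surjection from the restriction of `E` to `D = ∑ᵢ D i` onto the restriction of `E`
to `D i`, on a chart. -/
def toComponent (E : X.Modules) (i : I) (C : LogChart J) :
    (Γ(E, C.U.1) ⧸ ((∏ j, J j).ideal C.U • ⊤ : Submodule C.ring Γ(E, C.U.1))) →ₗ[C.ring]
      (Γ(E, C.U.1) ⧸ (C.ideal i • ⊤ : Submodule C.ring Γ(E, C.U.1))) :=
  Submodule.factor (Submodule.smul_mono_left (prod_ideal_le J i C.U))

/-- The filtration of the restriction of `E` to `D` attached to the residues of a logarithmic
connection, on a chart. On the restriction of `E` to `D i` it is the sum of the eigen-subsheaves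
for `m / r i`, `l i ≤ m < r i`; one takes the inverse images on `D`, and their intersection. -/
def LogConnection.residueFiltration {E : X.Modules} (D : LogConnection k J E) (r : I → ℕ)
    (l : I → ℤ) (C : LogChart J) :
    Submodule C.ring
      (Γ(E, C.U.1) ⧸ ((∏ j, J j).ideal C.U • ⊤ : Submodule C.ring Γ(E, C.U.1))) :=
  ⨅ i, (⨆ m : {m : Fin (r i) // l i ≤ m.1},
    D.eigenSubsheaf i C ((m.1.1 : ℕ) / (r i : k))).comap (toComponent E i C)

end Parabolic

end Geometry

end ParConn

end

/-! Fix `i` and let `G m` be the image of `E_{(m/r_i)e_i}` in `E_0|_{D_i}`. This is a decreasing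
filtration with `G 0` everything, and `G (r i) = 0` because pseudo-periodicity identifies the image
of `E_{e_i}` with `E_0(-D_i)`. Strong parabolicity at the index `(m/r_i)e_i`, carried to `E_0` by
the horizontal transition morphism, says that `res - m/r_i` sends `G m` into `G (m + 1)`. The
weights are distinct elements of a field, so their differences are units; linear algebra
(`filtration_eq_iSup_eigenspace`) then forces `G l` to be the sum of the eigenspaces for `m/r_i`
with `m ≥ l`. Taking `l = 0`, together with independence of the eigenspaces
(`isInternal_eigenspace`), gives semisimplicity.

For the filtration on `D`, it remains to see that `E_{l/r}` is the intersection in `E_0` of the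
`E_{(l_i/r_i)e_i}` (`mem_image_of_forall_mem`). Coordinates are added one at a time. If `s` lies in
the piece for `S` and in the piece for `i ∉ S`, then `f_i s` and `(∏_S f_j) s` both lie in the piece
for `S ∪ {i}`. Since `f_i` is regular and `f_i ∣ (∏_S f_j) a` implies `f_i ∣ a`, also with
coefficients in a vector bundle (`exists_eq_smul`), `f_i s` is `f_i` times a section of that piece;
cancelling `f_i` puts `s` there. The divisibility comes from the `D_j` being distinct integral
Cartier divisors (`dvd_of_mul_eq_mul`). -/

noncomputable section

/-! ### Local coordinates on vector bundles -/

namespace SheafOfModules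
open Limits
universe v₁ u₁
variable {C : Type u₁} [Category.{v₁} C] {J : GrothendieckTopology C} {R : Sheaf J RingCat.{u}}

lemma sum_val_app {M N : SheafOfModules.{u} R} {ι : Type*} (s : Finset ι) (f : ι → (M ⟶ N))
    (Y : Cᵒᵖ) (m : M.val.obj Y) :
    ((∑ i ∈ s, f i).val.app Y).hom m = ∑ i ∈ s, ((f i).val.app Y).hom m := by
  classical
  induction s using Finset.induction_on with
  | empty => rfl
  | insert a s ha ih => rw [Finset.sum_insert ha, Finset.sum_insert ha, ← ih]; rfl

variable [HasWeakSheafify J AddCommGrpCat.{u}] [J.WEqualsLocallyBijective AddCommGrpCat.{u}]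

open Classical in
/-- The coordinate projections of a free sheaf of modules. -/
def freeCoord {I : Type u} (i : I) : free (R := R) I ⟶ unit R :=
  Cofan.IsColimit.desc (isColimitFreeCofan I) fun j => if j = i then 𝟙 _ else 0

open Classical in
lemma ιFree_freeCoord {I : Type u} (i j : I) :
    ιFree (R := R) j ≫ freeCoord i = if j = i then 𝟙 _ else 0 :=
  (isColimitFreeCofan I).fac _ ⟨j⟩

lemma sum_freeCoord_ιFree {I : Type u} [Fintype I] :
    ∑ i : I, freeCoord i ≫ ιFree (R := R) i = 𝟙 (free I) := by
  classical
  refine Cofan.IsColimit.hom_ext (isColimitFreeCofan I) _ _ fun j => ?_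
  change ιFree j ≫ (∑ i : I, freeCoord i ≫ ιFree (R := R) i) = ιFree j ≫ 𝟙 _
  rw [Preadditive.comp_sum, Category.comp_id]
  simp only [← Category.assoc, ιFree_freeCoord]
  simp [ite_comp]

/-- The sections of a finite free sheaf of modules are a direct summand of a finite free module. -/
theorem exists_retract_of_iso_free {M : SheafOfModules.{u} R} {I : Type u} [Finite I]
    (e : free I ≅ M) (Y : Cᵒᵖ) :
    ∃ (f : M.val.obj Y →ₗ[R.obj.obj Y] (I → R.obj.obj Y))
      (g : (I → R.obj.obj Y) →ₗ[R.obj.obj Y] M.val.obj Y), g ∘ₗ f = LinearMap.id := by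
  classical
  have := Fintype.ofFinite I
  let p (i : I) : M.val.obj Y →ₗ[R.obj.obj Y] R.obj.obj Y :=
    ((e.inv ≫ freeCoord i).val.app Y).hom
  let s (i : I) : R.obj.obj Y →ₗ[R.obj.obj Y] M.val.obj Y :=
    ((ιFree i ≫ e.hom).val.app Y).hom
  refine ⟨LinearMap.pi p, ∑ i, s i ∘ₗ LinearMap.proj i, ?_⟩
  ext m
  have h : ∑ i : I, (e.inv ≫ freeCoord i) ≫ ιFree (R := R) i ≫ e.hom = 𝟙 M := by
    have := congr(e.inv ≫ $(sum_freeCoord_ιFree (R := R) (I := I)) ≫ e.hom)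
    simpa [Preadditive.comp_sum, Preadditive.sum_comp] using this
  have h2 := sum_val_app Finset.univ (fun i : I => (e.inv ≫ freeCoord i) ≫ ιFree (R := R) i ≫ e.hom) Y m
  rw [h] at h2
  rw [LinearMap.comp_apply, LinearMap.sum_apply]
  exact h2.symm

end SheafOfModules

namespace ParConn

/-- A retraction onto finitely many coordinates is all that is needed later: vanishing and
divisibility of sections are tested on coordinates and carried back by `g`. -/
theorem IsVectorBundle.exists_retract {X : Scheme.{u}} {E : X.Modules} (hE : IsVectorBundle E)
    (x : X) : ∃ V : X.Opens, x ∈ V ∧ ∀ W : X.Opens, W ≤ V → ∃ (n : Type u) (_ : Finite n)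
      (f : Γ(E, W) →ₗ[Γ(X, W)] (n → Γ(X, W))) (g : (n → Γ(X, W)) →ₗ[Γ(X, W)] Γ(E, W)),
      g ∘ₗ f = LinearMap.id := by
  obtain ⟨q, hq, hf⟩ := hE
  obtain ⟨V, i, ⟨j, ⟨hj⟩⟩, hx⟩ := q.coversTop ⊤ x trivial
  refine ⟨q.X j, leOfHom hj hx, fun W hW => ⟨(q.generators j).I, (hf.isFiniteType j).finite, ?_⟩⟩
  have := hq.isIso j
  have := (hf.isFiniteType j).finite
  -- Sections of `E` over `W` are the value of the restricted sheaf at `W`, seen as an object over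
  -- the trivializing open.
  exact SheafOfModules.exists_retract_of_iso_free (asIso (q.generators j).π)
    (op (Over.mk (homOfLE hW)))

/-! ### Regularity of the local equations, and division in vector bundles -/

section Regularity

variable {X : Scheme.{u}}

/-- The ideal is the kernel of restriction to the trace of the subscheme on `U`, whose ring of
sections is a domain, or zero if the trace is empty. -/
lemma ideal_eq_top_or_isPrime (J : X.IdealSheafData) [IsIntegral J.subscheme] (U : X.affineOpens) :
    J.ideal U = ⊤ ∨ (J.ideal U).IsPrime := by
  rw [← J.ker_subschemeι_app U]
  by_cases h : Nonempty (J.subschemeι ⁻¹ᵁ U.1)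
  · exact Or.inr (RingHom.ker_isPrime _)
  · left
    have : Subsingleton Γ(J.subscheme, J.subschemeι ⁻¹ᵁ U.1) := by
      have : J.subschemeι ⁻¹ᵁ U.1 = ⊥ := by
        ext x
        exact ⟨fun hx => (h ⟨⟨x, hx⟩⟩).elim, fun hx => hx.elim⟩
      rw [this]
      infer_instance
    rw [Ideal.eq_top_iff_one, RingHom.mem_ker]
    exact Subsingleton.elim _ _

/-- An integral closed subscheme is reduced, so its support determines it; the support is
irreducible, hence the closure of its trace on any open that it meets. -/
lemma eq_of_ideal_eq {J J' : X.IdealSheafData} [IsIntegral J.subscheme] [IsIntegral J'.subscheme]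
    (U : X.affineOpens) (h : J.ideal U = J'.ideal U) (hU : J.ideal U ≠ ⊤) : J = J' := by
  have hne (J : X.IdealSheafData) (hU : J.ideal U ≠ ⊤) : ((J.support : Set X) ∩ U.1).Nonempty := by
    by_contra! hemp
    apply hU
    have h1 : J.subschemeι ⁻¹ᵁ U.1 = ⊥ := by
      ext x
      refine ⟨fun hx => ?_, fun hx => hx.elim⟩
      have : J.subschemeι x ∈ (J.support : Set X) ∩ U.1 :=
        ⟨by rw [← J.range_subschemeι]; exact ⟨x, rfl⟩, hx⟩
      rw [hemp] at this
      exact this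
    have : Subsingleton Γ(J.subscheme, J.subschemeι ⁻¹ᵁ U.1) := by
      rw [h1]
      infer_instance
    rw [← J.ker_subschemeι_app U, Ideal.eq_top_iff_one, RingHom.mem_ker]
    exact Subsingleton.elim _ _
  have hsupp (J : X.IdealSheafData) [IsIntegral J.subscheme] (hU : J.ideal U ≠ ⊤) :
      (J.support : Set X) = closure ((J.support : Set X) ∩ U.1) := by
    refine subset_antisymm ?_ (closure_minimal Set.inter_subset_left J.support.isClosed)
    refine subset_closure_inter_of_isPreirreducible_of_isOpen ?_ U.1.isOpen (hne J hU)
    rw [← J.range_subschemeι, ← Set.image_univ]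
    exact (PreirreducibleSpace.isPreirreducible_univ).image _ J.subschemeι.continuous.continuousOn
  have hrad (J : X.IdealSheafData) [IsIntegral J.subscheme] : J.radical = J := by
    ext U : 2
    change (J.ideal U).radical = J.ideal U
    rcases ideal_eq_top_or_isPrime J U with h | h
    · rw [h, Ideal.radical_top]
    · exact h.radical
  rw [← hrad J, ← hrad J', ← Scheme.IdealSheafData.vanishingIdeal_support,
    ← Scheme.IdealSheafData.vanishingIdeal_support]
  congr 1
  apply SetLike.coe_injective
  rw [hsupp J hU, hsupp J' (h ▸ hU), J.coe_support_inter, J'.coe_support_inter, h]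

lemma exists_affineOpen_mem_le {U V : X.Opens} {x : X} (hU : x ∈ U) (hV : x ∈ V) :
    ∃ W : X.affineOpens, x ∈ W.1 ∧ W.1 ≤ U ∧ W.1 ≤ V := by
  obtain ⟨W, hW, hxW, hle⟩ := exists_isAffineOpen_mem_and_subset (U := U ⊓ V) ⟨hU, hV⟩
  exact ⟨⟨W, hW⟩, hxW, hle.trans inf_le_left, hle.trans inf_le_right⟩

/-- The Cartier condition provides a regular generator only on some neighbourhood of each point. On
a smaller basic open any other generator divides it, hence is regular too, and regularity is local.
-/
lemma mem_nonZeroDivisors_of_isEffectiveCartier {J : X.IdealSheafData} (hJ : IsEffectiveCartier J)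
    (U : X.affineOpens) {f : Γ(X, U.1)} (hf : J.ideal U = Ideal.span {f}) :
    f ∈ nonZeroDivisors Γ(X, U.1) := by
  have key : ∀ x : U.1, ∃ W : X.affineOpens, x.1 ∈ W.1 ∧ ∃ h : W.1 ≤ U.1,
      (X.presheaf.map (homOfLE h).op).hom f ∈ nonZeroDivisors Γ(X, W.1) := by
    rintro ⟨x, hx⟩
    obtain ⟨V, hxV, g, hg, hgV⟩ := hJ x
    obtain ⟨a, b, hab, hxa⟩ := exists_basicOpen_le_affine_inter U.2 V.2 x ⟨hx, hxV⟩
    have hV : X.basicOpen b ≤ V.1 := X.basicOpen_le b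
    have hU : X.basicOpen b ≤ U.1 := hab ▸ X.basicOpen_le a
    refine ⟨X.affineBasicOpen b, hab.le hxa, hU, ?_⟩
    have hloc := V.2.isLocalization_basicOpen b
    have hg' : (X.presheaf.map (homOfLE hV).op).hom g ∈ nonZeroDivisors Γ(X, X.basicOpen b) :=
      IsLocalization.map_nonZeroDivisors_le (.powers b) Γ(X, X.basicOpen b) ⟨g, hg, rfl⟩
    have h1 := J.map_ideal (U := X.affineBasicOpen b) (V := U) hU
    have h2 := J.map_ideal (U := X.affineBasicOpen b) (V := V) hV
    rw [hf, Ideal.map_span, Set.image_singleton] at h1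
    rw [hgV, Ideal.map_span, Set.image_singleton, ← h1] at h2
    obtain ⟨c, hc⟩ := Ideal.mem_span_singleton.mp (h2.le (Ideal.mem_span_singleton_self _))
    exact (mul_mem_nonZeroDivisors.mp (hc ▸ hg')).1
  choose W hxW hWU hW using key
  rw [mem_nonZeroDivisors_iff_right]
  intro y hy
  refine X.sheaf.eq_of_locally_eq' (fun x => (W x).1) U.1 (fun x => homOfLE (hWU x))
    (fun x hx => Opens.mem_iSup.mpr ⟨⟨x, hx⟩, hxW ⟨x, hx⟩⟩) y 0 fun x => ?_
  have := congr((X.presheaf.map (homOfLE (hWU x)).op).hom $hy)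
  rw [map_mul, map_zero] at this
  have h0 := (mem_nonZeroDivisors_iff_right.mp (hW x)) _ this
  exact h0.trans (map_zero (X.presheaf.map (homOfLE (hWU x)).op).hom).symm

/-- Local equations of two distinct integral Cartier divisors form a regular sequence. -/
lemma dvd_of_mul_eq_mul {J J' : X.IdealSheafData} [IsIntegral J.subscheme] [IsIntegral J'.subscheme]
    (hJ : IsEffectiveCartier J) (hne : J ≠ J') (U : X.affineOpens) {f f' : Γ(X, U.1)}
    (hf : J.ideal U = Ideal.span {f}) (hf' : J'.ideal U = Ideal.span {f'}) {a : Γ(X, U.1)}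
    (h : f' ∣ f * a) : f' ∣ a := by
  have hreg := mem_nonZeroDivisors_of_isEffectiveCartier hJ U hf
  rcases ideal_eq_top_or_isPrime J' U with h' | h'
  · rw [hf', Ideal.span_singleton_eq_top] at h'
    exact h'.dvd
  rw [← Ideal.mem_span_singleton, ← hf'] at h ⊢
  -- Suppose `f` lies in the prime `J'`, so `f = f' * b`, and use that `J` is prime as well. Either
  -- `f'` lies in `J` and the two divisors agree, or `b = f * c` and cancelling `f` makes `f'` a
  -- unit.
  refine (h'.mem_or_mem h).resolve_left fun hff' => ?_
  have hle : J.ideal U ≤ J'.ideal U := by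
    rw [hf, Ideal.span_le]
    simpa using hff'
  have hJU : J.ideal U ≠ ⊤ := fun e => h'.ne_top (top_le_iff.mp (e ▸ hle))
  have hp := (ideal_eq_top_or_isPrime J U).resolve_left hJU
  rw [hf', Ideal.mem_span_singleton] at hff'
  obtain ⟨b, hb⟩ := hff'
  have hm : f' * b ∈ J.ideal U := by
    rw [← hb, hf]
    exact Ideal.mem_span_singleton_self f
  rcases hp.mem_or_mem hm with h1 | h1
  · refine hne (eq_of_ideal_eq U (le_antisymm hle ?_) hJU)
    rw [hf', Ideal.span_le]
    simpa using h1
  · rw [hf, Ideal.mem_span_singleton] at h1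
    obtain ⟨c, rfl⟩ := h1
    have : (f' * c - 1) * f = 0 := by linear_combination -hb
    have := sub_eq_zero.mp ((mem_nonZeroDivisors_iff_right.mp hreg) _ this)
    apply h'.ne_top
    rw [hf', Ideal.span_singleton_eq_top]
    exact IsUnit.of_mul_eq_one _ this

namespace IsVectorBundle

variable {E : X.Modules} (hE : IsVectorBundle E) (U : X.Opens)

-- In local coordinates this is regularity of `f` in the structure sheaf. `U` is an arbitrary open
-- because the lemma is also applied to intersections of affine opens, when gluing quotients;
-- regularity is therefore required on the affine opens inside `U`.
include hE in
lemma eq_zero_of_smul_eq_zero {f : Γ(X, U)}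
    (hf : ∀ (W : X.affineOpens) (h : W.1 ≤ U),
      (X.presheaf.map (homOfLE h).op).hom f ∈ nonZeroDivisors Γ(X, W.1))
    {s : Γ(E, U)} (hs : f • s = 0) : s = 0 := by
  have key : ∀ x : U, ∃ W : X.affineOpens, x.1 ∈ W.1 ∧ ∃ h : W.1 ≤ U, resM E h s = 0 := by
    rintro ⟨x, hx⟩
    obtain ⟨V, hxV, hV⟩ := hE.exists_retract x
    obtain ⟨W, hxW, hWU, hWV⟩ := exists_affineOpen_mem_le hx hxV
    refine ⟨W, hxW, hWU, ?_⟩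
    obtain ⟨n, _, p, q, hpq⟩ := hV W.1 hWV
    have h1 := congr(p (resM E hWU $hs))
    rw [resM_smul, map_zero, map_zero, map_smul] at h1
    have h2 : p (resM E hWU s) = 0 := by
      ext j
      have := congr_fun h1 j
      rw [Pi.smul_apply, smul_eq_mul] at this
      exact (mem_nonZeroDivisors_iff.mp (hf W hWU)).1 _ this
    rw [← LinearMap.id_apply (R := Γ(X, W.1)) (resM E hWU s), ← hpq, LinearMap.comp_apply, h2,
      map_zero]
  choose W hxW hWU hW using key
  refine TopCat.Sheaf.eq_of_locally_eq' ⟨E.presheaf, E.isSheaf⟩ (fun x => (W x).1) U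
    (fun x => homOfLE (hWU x)) (fun x hx => Opens.mem_iSup.mpr ⟨⟨x, hx⟩, hxW ⟨x, hx⟩⟩) s 0
    fun x => ?_
  exact (hW x).trans (map_zero (resM E (hWU x))).symm

-- Coordinatewise, `f` divides `g` times each coordinate of `s`, hence the coordinate itself. The
-- local quotients are unique because `f` is regular, so they agree on overlaps and glue.
include hE in
lemma exists_eq_smul {f g : Γ(X, U)}
    (hf : ∀ (W : X.affineOpens) (h : W.1 ≤ U),
      (X.presheaf.map (homOfLE h).op).hom f ∈ nonZeroDivisors Γ(X, W.1))
    (hfg : ∀ (W : X.affineOpens) (h : W.1 ≤ U) (a : Γ(X, W.1)),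
      (X.presheaf.map (homOfLE h).op).hom f ∣ (X.presheaf.map (homOfLE h).op).hom g * a →
        (X.presheaf.map (homOfLE h).op).hom f ∣ a)
    {s t : Γ(E, U)} (hst : g • s = f • t) : ∃ t' : Γ(E, U), s = f • t' := by
  have key : ∀ x : U, ∃ W : X.affineOpens, x.1 ∈ W.1 ∧ ∃ h : W.1 ≤ U, ∃ t' : Γ(E, W.1),
      resM E h s = (X.presheaf.map (homOfLE h).op).hom f • t' := by
    rintro ⟨x, hx⟩
    obtain ⟨V, hxV, hV⟩ := hE.exists_retract x
    obtain ⟨W, hxW, hWU, hWV⟩ := exists_affineOpen_mem_le hx hxV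
    obtain ⟨n, _, p, q, hpq⟩ := hV W.1 hWV
    have h1 := congr(p (resM E hWU $hst))
    rw [resM_smul, resM_smul, map_smul, map_smul] at h1
    have h2 : ∀ j, (X.presheaf.map (homOfLE hWU).op).hom f ∣ p (resM E hWU s) j := fun j =>
      hfg W hWU _ ⟨_, congr_fun h1 j⟩
    choose c hc using h2
    refine ⟨W, hxW, hWU, q c, ?_⟩
    rw [← map_smul, ← LinearMap.id_apply (R := Γ(X, W.1)) (resM E hWU s), ← hpq,
      LinearMap.comp_apply]
    congr 1
    ext j
    exact hc j
  choose W hxW hWU t' ht' using key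
  have hcov : U ≤ ⨆ x, (W x).1 := fun x hx => Opens.mem_iSup.mpr ⟨⟨x, hx⟩, hxW ⟨x, hx⟩⟩
  have hres {U₁ U₂ U₃ : X.Opens} (h₁ : U₁ ≤ U₂) (h₂ : U₂ ≤ U₃) (y : Γ(E, U₃)) :
      resM E h₁ (resM E h₂ y) = resM E (h₁.trans h₂) y := by
    have := E.presheaf.map_comp (homOfLE h₂).op (homOfLE h₁).op
    exact congr($(this) y).symm
  have hresX {U₁ U₂ U₃ : X.Opens} (h₁ : U₁ ≤ U₂) (h₂ : U₂ ≤ U₃) (y : Γ(X, U₃)) :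
      (X.presheaf.map (homOfLE h₁).op).hom ((X.presheaf.map (homOfLE h₂).op).hom y) =
        (X.presheaf.map (homOfLE (h₁.trans h₂)).op).hom y := by
    have := X.presheaf.map_comp (homOfLE h₂).op (homOfLE h₁).op
    exact congr($(this) y).symm
  obtain ⟨t₀, ht₀, -⟩ := TopCat.Sheaf.existsUnique_gluing' ⟨E.presheaf, E.isSheaf⟩
    (fun x => (W x).1) U (fun x => homOfLE (hWU x)) hcov t' (by
      intro x y
      have hx : (W x).1 ⊓ (W y).1 ≤ (W x).1 := inf_le_left
      have hy : (W x).1 ⊓ (W y).1 ≤ (W y).1 := inf_le_right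
      change resM E hx (t' x) = resM E hy (t' y)
      rw [← sub_eq_zero]
      refine hE.eq_zero_of_smul_eq_zero ((W x).1 ⊓ (W y).1)
        (f := (X.presheaf.map (homOfLE (hx.trans (hWU x))).op).hom f) (fun V hV => ?_) ?_
      · rw [hresX]
        exact hf V _
      · have h1 := congr(resM E hx $(ht' x))
        have h2 := congr(resM E hy $(ht' y))
        rw [resM_smul, hres, hresX] at h1 h2
        rw [smul_sub, ← h1, ← h2, sub_self])
  refine ⟨t₀, ?_⟩
  refine TopCat.Sheaf.eq_of_locally_eq' ⟨E.presheaf, E.isSheaf⟩ (fun x => (W x).1) U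
    (fun x => homOfLE (hWU x)) hcov s (f • t₀) fun x => ?_
  change resM E (hWU x) s = resM E (hWU x) (f • t₀)
  rw [resM_smul, ht' x]
  congr 1
  exact (ht₀ x).symm

end IsVectorBundle

end Regularity

/-! ### Linear algebra: filtrations by eigenspaces over a ring -/

section EigenFiltration

open Polynomial

variable {A M : Type*} [CommRing A] [AddCommGroup M] [Module A M] (R : Module.End A M) {c : ℕ → A}

lemma eigenspace_eq_ker_aeval (a : A) : R.eigenspace a = LinearMap.ker (aeval R (X - C a)) := by
  ext x
  simp [sub_eq_zero]

lemma isCoprime_prod_X_sub_C {s : Finset ℕ} {n : ℕ} (h : ∀ m ∈ s, IsUnit (c n - c m)) :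
    IsCoprime (X - C (c n)) (∏ m ∈ s, (X - C (c m))) :=
  IsCoprime.prod_right fun m hm => isCoprime_X_sub_C_of_isUnit_sub (h m hm)

/-- Differences of the roots being units, the linear factors are pairwise coprime, and the kernel of
a product of coprime polynomials in `R` is the sum of the kernels. No field is needed. -/
lemma ker_aeval_prod_X_sub_C (s : Finset ℕ)
    (h : ∀ m ∈ s, ∀ n ∈ s, m ≠ n → IsUnit (c m - c n)) :
    LinearMap.ker (aeval R (∏ m ∈ s, (X - C (c m)))) = ⨆ m ∈ s, R.eigenspace (c m) := by
  induction s using Finset.induction_on with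
  | empty => ext; simp
  | insert n s hn ih =>
    rw [Finset.prod_insert hn, ← sup_ker_aeval_eq_ker_aeval_mul_of_coprime R
      (isCoprime_prod_X_sub_C fun m hm => h n (by simp) m (by simp [hm]) (by grind)),
      ih fun m hm n hn => h m (by simp [hm]) n (by simp [hn]), ← eigenspace_eq_ker_aeval,
      Finset.iSup_insert]

variable {r : ℕ} {G : ℕ → Submodule A M}

/-- If `R` acts as `c m` on the `m`-th step of a filtration and the `c m - c n` are units, then the
filtration is the one by the eigenspaces of `R`. -/
theorem filtration_eq_iSup_eigenspace (hc : ∀ m < r, ∀ n < r, m ≠ n → IsUnit (c m - c n))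
    (hG : Antitone G) (h0 : G 0 = ⊤) (hr : G r = ⊥)
    (h : ∀ m < r, ∀ x ∈ G m, R x - c m • x ∈ G (m + 1)) {l : ℕ} (hl : l ≤ r) :
    G l = ⨆ m ∈ Finset.Ico l r, R.eigenspace (c m) := by
  apply le_antisymm
  · rw [← ker_aeval_prod_X_sub_C R _ fun m hm n hn =>
      hc m (Finset.mem_Ico.mp hm).2 n (Finset.mem_Ico.mp hn).2]
    induction hl using Nat.decreasingInduction with
    | self => simp [hr]
    | of_succ l hl ih =>
      intro x hx
      -- `R - c l` moves `G l` into `G (l + 1)`, which the product of the remaining factors kills.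
      have := ih (h l hl x hx)
      rw [LinearMap.mem_ker] at this ⊢
      rw [Finset.prod_eq_prod_Ico_succ_bot hl, mul_comm, map_mul, Module.End.mul_apply]
      simpa using this
  · refine iSup₂_le fun m hm x hx => ?_
    rw [Finset.mem_Ico] at hm
    rw [Module.End.mem_eigenspace_iff] at hx
    refine hG hm.1 ?_
    -- An eigenvector for `c m` climbs the filtration: if `x ∈ G j` with `j < m`, then `R x - c j •
    -- x = (c m - c j) • x` lies in `G (j + 1)`, and the scalar is a unit.
    have key : ∀ j ≤ m, x ∈ G j := by
      intro j
      induction j with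
      | zero => simp [h0]
      | succ j ih =>
        intro hj
        have h1 := h j (by omega) x (ih (by omega))
        rw [hx, ← sub_smul] at h1
        exact (Submodule.smul_mem_iff_of_isUnit _ (hc m hm.2 j (by omega) (by omega))).mp h1
    exact key m le_rfl

/-- Independence holds because `X - c n` is coprime to the product of the other factors, so their
kernels are disjoint. -/
theorem isInternal_eigenspace (hc : ∀ m < r, ∀ n < r, m ≠ n → IsUnit (c m - c n))
    (htop : ⨆ m ∈ Finset.Ico 0 r, R.eigenspace (c m) = ⊤) :
    DirectSum.IsInternal fun m : Fin r => R.eigenspace (c m) := by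
  rw [DirectSum.isInternal_submodule_iff_iSupIndep_and_iSup_eq_top]
  constructor
  · intro n
    have h1 := disjoint_ker_aeval_of_isCoprime R (isCoprime_prod_X_sub_C (c := c) (n := n)
      (s := (Finset.range r).erase n) fun m hm => by
        rw [Finset.mem_erase, Finset.mem_range] at hm
        exact hc n n.2 m hm.2 hm.1.symm)
    rw [← eigenspace_eq_ker_aeval, ker_aeval_prod_X_sub_C] at h1
    · refine h1.mono_right (iSup₂_le fun m hm => ?_)
      exact le_iSup₂_of_le m.1 (by simpa [Fin.val_inj] using hm) le_rfl
    · intro m hm n hn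
      simp only [Finset.mem_erase, Finset.mem_range] at hm hn
      exact hc m hm.2 n hn.2
  · rw [eq_top_iff, ← htop]
    refine iSup₂_le fun m hm => ?_
    exact le_iSup (fun m : Fin r => R.eigenspace (c m)) ⟨m, (Finset.mem_Ico.mp hm).2⟩

end EigenFiltration

/-! ### Functoriality of residues -/

section Residue

variable {k A I : Type*} [CommRing k] [CommRing A] [Algebra k A] {J : I → Ideal A}
  {M N : Type*} [AddCommGroup M] [Module A M] [AddCommGroup N] [Module A N]

/-- The map on quotients by `K` induced by a linear map. -/
def mapQuotSMul (K : Ideal A) (φ : M →ₗ[A] N) :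
    M ⧸ (K • ⊤ : Submodule A M) →ₗ[A] N ⧸ (K • ⊤ : Submodule A N) :=
  Submodule.mapQ _ _ φ (Submodule.map_le_iff_le_comap.mp (by
    rw [Submodule.map_smul'']
    exact smul_mono_right _ le_top))

/-- The residue applies `res` to the form factor of the tensor product and `φ` acts on the module
factor, so the two commute. -/
lemma residue_mapQuotSMul (D : ModuleLogConnection k J M) (D' : ModuleLogConnection k J N)
    (φ : M →ₗ[A] N)
    (h : ∀ m, φ.rTensor (LogDifferentials k J) (D.nabla m) = D'.nabla (φ m)) (i : I)
    (x : M ⧸ (J i • ⊤ : Submodule A M)) :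
    D'.residue i (mapQuotSMul (J i) φ x) = mapQuotSMul (J i) φ (D.residue i x) := by
  have key (t : M ⊗[A] (A ⧸ J i)) :
      TensorProduct.tensorQuotEquivQuotSMul N (J i) (φ.rTensor _ t) =
        mapQuotSMul (J i) φ (TensorProduct.tensorQuotEquivQuotSMul M (J i) t) := by
    induction t with
    | zero => simp
    | add a b ha hb => simp only [map_add, ha, hb]
    | tmul m a =>
      obtain ⟨a, rfl⟩ := Ideal.Quotient.mk_surjective a
      simp [mapQuotSMul]
  obtain ⟨m, rfl⟩ := Submodule.mkQ_surjective _ x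
  change TensorProduct.tensorQuotEquivQuotSMul N (J i)
    ((LogDifferentials.res k J i).lTensor N (D'.nabla (φ m))) =
    mapQuotSMul (J i) φ (TensorProduct.tensorQuotEquivQuotSMul M (J i)
      ((LogDifferentials.res k J i).lTensor M (D.nabla m)))
  rw [← h, ← key, ← LinearMap.comp_apply, ← LinearMap.comp_apply, LinearMap.lTensor_comp_rTensor,
    LinearMap.rTensor_comp_lTensor]

end Residue

/-! ### Transition morphisms of a parabolic bundle -/

section Parabolic

variable {X : Scheme.{u}} {I : Type*} [Fintype I] {J : I → X.IdealSheafData} {r : I → ℕ}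

lemma ideal_prod {ι : Type*} (s : Finset ι) (K : ι → X.IdealSheafData) (U : X.affineOpens) :
    (∏ i ∈ s, K i).ideal U = ∏ i ∈ s, (K i).ideal U := by
  classical
  induction s using Finset.induction_on with
  | empty => simp [Ideal.one_eq_top]
  | insert a s ha ih => rw [Finset.prod_insert ha, Finset.prod_insert ha, ← ih]; rfl

lemma divisorIdeal_ideal (l : I → ℤ) (U : X.affineOpens) :
    (divisorIdeal J l).ideal U = ∏ i, (J i).ideal U ^ (l i).toNat :=
  ideal_prod _ _ _

section Indicator

variable [DecidableEq I]

/-- The indicator function of a finite set of divisors. -/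
def indicator (S : Finset I) : I → ℤ := fun i => if i ∈ S then 1 else 0

omit [Fintype I] in
lemma indicator_nonneg (S : Finset I) : 0 ≤ indicator S := fun i => by
  simp only [indicator, Pi.zero_apply]
  split_ifs <;> simp

lemma divisorIdeal_indicator (S : Finset I) (U : X.affineOpens) :
    (divisorIdeal J (indicator S)).ideal U = ∏ i ∈ S, (J i).ideal U := by
  rw [divisorIdeal_ideal, ← Finset.prod_subset (Finset.subset_univ S)]
  · exact Finset.prod_congr rfl fun i hi => by simp [indicator, hi]
  · intro i _ hi
    simp [indicator, hi]

end Indicator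

lemma divisorIdeal_of_nonpos {l : I → ℤ} (hl : l ≤ 0) (U : X.affineOpens) :
    (divisorIdeal J l).ideal U = ⊤ := by
  rw [divisorIdeal_ideal, ← Ideal.one_eq_top]
  exact Finset.prod_eq_one fun i _ => by rw [Int.toNat_of_nonpos (hl i), pow_zero]

namespace ParabolicBundle

variable (P : ParabolicBundle J r)

/-- The image of `E_b` in `E_a` on an affine open, for `a ≤ b`. -/
def image {a b : I → ℤ} (h : a ≤ b) (U : X.affineOpens) :
    Submodule Γ(X, U.1) Γ(P.E.obj (op a), U.1) :=
  LinearMap.range (appLinear (trans P.E h) U.1)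

lemma trans_trans {a b c : I → ℤ} (h : a ≤ b) (h' : b ≤ c) (U : X.Opens)
    (s : Γ(P.E.obj (op c), U)) :
    appLinear (trans P.E h) U (appLinear (trans P.E h') U s) =
      appLinear (trans P.E (h.trans h')) U s := by
  have : trans P.E h' ≫ trans P.E h = trans P.E (h.trans h') := by
    rw [trans, trans, ← P.E.map_comp]
    rfl
  rw [← this]
  rfl

lemma trans_refl {a : I → ℤ} (h : a ≤ a) (U : X.Opens) (s : Γ(P.E.obj (op a), U)) :
    appLinear (trans P.E h) U s = s := by
  have : trans P.E h = 𝟙 _ := P.E.map_id (op a)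
  rw [this]
  rfl

lemma image_anti {a b c : I → ℤ} (h : a ≤ b) (h' : a ≤ c) (hbc : b ≤ c) (U : X.affineOpens) :
    P.image h' U ≤ P.image h U := by
  rintro _ ⟨s, rfl⟩
  exact ⟨appLinear (trans P.E hbc) U.1 s, P.trans_trans h hbc U.1 s⟩

lemma image_eq_top {a b : I → ℤ} (h : a ≤ b) (h' : b ≤ a) (U : X.affineOpens) :
    P.image h U = ⊤ :=
  eq_top_iff.mpr fun s _ => ⟨appLinear (trans P.E h') U.1 s, by rw [trans_trans, trans_refl]⟩

/-- For `l ≥ 0` the twist by `l⁻` is trivial, so `per` is defined on all sections. -/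
lemma mem_twist_neg {l : I → ℤ} (hl : 0 ≤ l) {E : X.Modules} (U : X.affineOpens) (s : Γ(E, U.1)) :
    s ∈ twist J E (-l) U := by
  rw [twist, divisorIdeal_of_nonpos (neg_nonpos.mpr hl)]
  simp

/-- By `per_comp` the transition morphism is an isomorphism onto `E_a(-l • D)` followed by the
inclusion. -/
lemma image_shift {l : I → ℤ} (hl : 0 ≤ l) (a : I → ℤ) (U : X.affineOpens) :
    P.image (le_shift r a hl) U = (divisorIdeal J l).ideal U • ⊤ := by
  apply le_antisymm
  · rintro _ ⟨s, rfl⟩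
    rw [← P.per_comp l hl a U ⟨s, mem_twist_neg hl U s⟩]
    exact (P.per l a U _).2
  · intro s hs
    refine ⟨((P.per l a U).symm ⟨s, hs⟩).1, ?_⟩
    rw [← P.per_comp l hl a U]
    simp

lemma trans_shift_injective {l : I → ℤ} (hl : 0 ≤ l) (a : I → ℤ) (U : X.affineOpens) :
    Function.Injective (appLinear (trans P.E (le_shift r a hl)) U.1) := by
  intro s t hst
  rw [← P.per_comp l hl a U ⟨s, mem_twist_neg hl U s⟩,
    ← P.per_comp l hl a U ⟨t, mem_twist_neg hl U t⟩] at hst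
  simpa using hst

lemma smul_mem_image {a b l : I → ℤ} (h : a ≤ b) (hl : 0 ≤ l) (U : X.affineOpens) {g : Γ(X, U.1)}
    (hg : g ∈ (divisorIdeal J l).ideal U) {s : Γ(P.E.obj (op a), U.1)} (hs : s ∈ P.image h U) :
    g • s ∈ P.image (h.trans (le_shift r b hl)) U := by
  obtain ⟨t, rfl⟩ := hs
  have : g • t ∈ P.image (le_shift r b hl) U := by
    rw [P.image_shift hl]
    exact Submodule.smul_mem_smul hg trivial
  obtain ⟨z, hz⟩ := this
  exact ⟨z, by rw [← map_smul, ← hz, P.trans_trans h (le_shift r b hl)]⟩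

variable (hJ : ∀ i, IsEffectiveCartier (J i)) (hr : ∀ i, 1 ≤ r i) (U : X.affineOpens)
  {f : I → Γ(X, U.1)} (hf : ∀ i, (J i).ideal U = Ideal.span {f i})

include hf in
omit [Fintype I] in
lemma ideal_eq_span_res {W : X.affineOpens} (h : W.1 ≤ U.1) (i : I) :
    (J i).ideal W = Ideal.span {(X.presheaf.map (homOfLE h).op).hom (f i)} := by
  rw [← (J i).map_ideal (U := W) (V := U) h, hf, Ideal.map_span, Set.image_singleton]
  rfl

include hJ hf in
omit [Fintype I] in
lemma res_mem_nonZeroDivisors {W : X.affineOpens} (h : W.1 ≤ U.1) (i : I) :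
    (X.presheaf.map (homOfLE h).op).hom (f i) ∈ nonZeroDivisors Γ(X, W.1) :=
  mem_nonZeroDivisors_of_isEffectiveCartier (hJ i) W (ideal_eq_span_res U hf h i)

-- Let `x` die in `E_a` and let `g` be an equation of `(b - a) • D`. Then `g • x` comes from some
-- `z` in `E` at index `shift r b (b - a)`. The image of `z` at `shift r a (b - a)` dies in `E_a`,
-- hence is zero, since transitions along integral shifts are injective. As `r ≥ 1`, this index lies
-- above `b`, so `g • x = 0` and `x = 0`.
include hJ hr hf in
lemma trans_injective {a b : I → ℤ} (h : a ≤ b) :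
    Function.Injective (appLinear (trans P.E h) U.1) := by
  rw [injective_iff_map_eq_zero]
  intro x hx
  have hl : 0 ≤ b - a := sub_nonneg.mpr h
  have hb : b ≤ shift r a (b - a) := fun i => by
    have h1 := hl i
    have h2 : (1 : ℤ) ≤ r i := by exact_mod_cast hr i
    simp only [Pi.zero_apply, shift, Pi.sub_apply] at h1 ⊢
    nlinarith
  have hg : ∏ i, f i ^ ((b - a) i).toNat ∈ (divisorIdeal J (b - a)).ideal U := by
    rw [divisorIdeal_ideal]
    refine Ideal.prod_mem_prod fun i _ => Ideal.pow_mem_pow ?_ _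
    rw [hf]
    exact Ideal.mem_span_singleton_self _
  refine (P.isVectorBundle (op b)).eq_zero_of_smul_eq_zero U.1 (f := ∏ i, f i ^ ((b - a) i).toNat)
    (fun W hW => ?_) ?_
  · rw [map_prod]
    refine prod_mem fun i _ => ?_
    rw [map_pow]
    exact pow_mem (res_mem_nonZeroDivisors hJ U hf hW i) _
  · have : (∏ i, f i ^ ((b - a) i).toNat) • x ∈ P.image (le_shift r b hl) U := by
      rw [P.image_shift hl]
      exact Submodule.smul_mem_smul hg trivial
    obtain ⟨z, hz⟩ := this
    have hz' : appLinear (trans P.E (shift_mono r h (b - a))) U.1 z = 0 := by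
      apply P.trans_shift_injective hl a U
      rw [trans_trans, map_zero, ← P.trans_trans h (le_shift r b hl), hz, map_smul, hx, smul_zero]
    rw [← hz, ← P.trans_trans hb (shift_mono r h (b - a)), hz', map_zero]

variable (hint : ∀ i, IsIntegral (J i).subscheme) (hinj : Function.Injective J)

include hJ hf hint hinj in
omit [Fintype I] in
lemma dvd_of_dvd_prod_mul {W : X.affineOpens} (h : W.1 ≤ U.1) {i : I} {S : Finset I} (hi : i ∉ S)
    {a : Γ(X, W.1)} (ha : (X.presheaf.map (homOfLE h).op).hom (f i) ∣
      (X.presheaf.map (homOfLE h).op).hom (∏ j ∈ S, f j) * a) :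
    (X.presheaf.map (homOfLE h).op).hom (f i) ∣ a := by
  classical
  induction S using Finset.induction_on with
  | empty => simpa using ha
  | insert j S hj ih =>
    rw [Finset.mem_insert, not_or] at hi
    rw [Finset.prod_insert hj, map_mul, mul_assoc] at ha
    have := hint i
    have := hint j
    exact ih hi.2 (dvd_of_mul_eq_mul (hJ j) (hinj.ne (Ne.symm hi.1)) W
      (ideal_eq_span_res U hf h j) (ideal_eq_span_res U hf h i) ha)

include hJ hr hf hint hinj in
/-- The subsheaf `E_l` of `E_0` is the intersection of the subsheaves `E_{l i • e i}`. -/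
theorem mem_image_of_forall_mem [DecidableEq I] {l : I → ℤ} (hl : 0 ≤ l) (hlr : ∀ i, l i ≤ r i)
    {s : Γ(P.E.obj (op 0), U.1)}
    (hs : ∀ i, s ∈ P.image (Pi.single_nonneg.mpr (hl i) : 0 ≤ Pi.single i (l i)) U) :
    s ∈ P.image hl U := by
  have hprod (S : Finset I) : ∏ j ∈ S, f j ∈ (divisorIdeal J (indicator S)).ideal U := by
    rw [divisorIdeal_indicator]
    refine Ideal.prod_mem_prod fun i _ => ?_
    rw [hf]
    exact Ideal.mem_span_singleton_self _
  have hnn (S : Finset I) : (0 : I → ℤ) ≤ fun j => if j ∈ S then l j else 0 := fun j => by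
    have := hl j
    simp only [Pi.zero_apply] at this ⊢
    split_ifs <;> simp [this]
  -- The index is `l` on `S` and zero elsewhere; one coordinate is added at a time.
  have key (S : Finset I) : s ∈ P.image (hnn S) U := by
    induction S using Finset.induction_on with
    | empty =>
      rw [P.image_eq_top _ fun i => by simp]
      trivial
    | insert i S hi ih =>
      -- Multiplication by `f i` raises the `i`-th index by `r i`, which is enough because `l i ≤ r
      -- i`. In the next claim the product over `S` does the same for the coordinates in `S`,
      -- starting from the membership at `i` alone.
      have h1 : f i • s ∈ P.image (hnn (insert i S)) U := by
        have h := P.smul_mem_image (hnn S) (indicator_nonneg {i}) U (hprod {i}) ih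
        rw [Finset.prod_singleton] at h
        refine P.image_anti _ _ (fun j => ?_) U h
        have := hlr j
        have := hl j
        simp only [shift, indicator, Finset.mem_insert, Finset.mem_singleton, Pi.zero_apply] at *
        split_ifs <;> grind
      have h2 : (∏ j ∈ S, f j) • s ∈ P.image (hnn (insert i S)) U := by
        have h := P.smul_mem_image _ (indicator_nonneg S) U (hprod S) (hs i)
        refine P.image_anti _ _ (fun j => ?_) U h
        have := hlr j
        have := hl j
        simp only [shift, indicator, Finset.mem_insert, Pi.single_apply, Pi.zero_apply] at *
        split_ifs <;> grind
      obtain ⟨n₁, hn₁⟩ := h1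
      obtain ⟨n₂, hn₂⟩ := h2
      -- Both sides have image `(f i * ∏ j ∈ S, f j) • s` in `E_0`, and the transition morphism is
      -- injective.
      have h3 : (∏ j ∈ S, f j) • n₁ = f i • n₂ := by
        apply P.trans_injective hJ hr U hf (hnn (insert i S))
        rw [map_smul, map_smul, hn₁, hn₂, smul_comm]
      have hreg (W : X.affineOpens) (hW : W.1 ≤ U.1) := res_mem_nonZeroDivisors hJ U hf hW i
      obtain ⟨t, rfl⟩ := (P.isVectorBundle _).exists_eq_smul U.1 hreg
        (fun W hW a ha => dvd_of_dvd_prod_mul hJ U hf hint hinj hW hi ha) h3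
      -- In `E_0` the image of `t` satisfies `f i • t = f i • s`; cancel `f i`.
      refine ⟨t, sub_eq_zero.mp ?_⟩
      refine (P.isVectorBundle (op 0)).eq_zero_of_smul_eq_zero U.1 hreg ?_
      rw [smul_sub, ← map_smul, hn₁, sub_self]
  refine P.image_anti _ _ (fun j => ?_) U (key Finset.univ)
  simp

end ParabolicBundle

end Parabolic

/-! ### Strongly parabolic connections: comparison of the two filtrations -/

namespace ParabolicConnection

variable {k : Type u} [Field k] {X : Scheme.{u}} [X.Over (Spec (.of k))] {I : Type*} [Fintype I]
  [DecidableEq I] {J : I → X.IdealSheafData} {r : I → ℕ} (P : ParabolicConnection k J r)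
  (i : I) (C : LogChart J)

omit [Fintype I] in
lemma single_natCast_nonneg (i : I) (m : ℕ) : (0 : I → ℤ) ≤ Pi.single i (m : ℤ) :=
  Pi.single_nonneg.mpr (Int.natCast_nonneg m)

/-- The filtration of the restriction of `E_0` to `D i` by the images of the `E_{m • e i}`. -/
def componentFiltration (m : ℕ) :
    Submodule C.ring (Γ(P.E.obj (op 0), C.U.1) ⧸
      (C.ideal i • ⊤ : Submodule C.ring Γ(P.E.obj (op 0), C.U.1))) :=
  P.imageIn (single_natCast_nonneg i m) C.U (C.ideal i)

lemma componentFiltration_antitone : Antitone (P.componentFiltration i C) := fun m n h =>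
  Submodule.map_mono (P.image_anti _ _ (Pi.single_le_single.mpr (by exact_mod_cast h)) C.U)

lemma componentFiltration_zero : P.componentFiltration i C 0 = ⊤ := by
  have : P.image (single_natCast_nonneg i 0) C.U = ⊤ := P.image_eq_top _ (by simp) C.U
  change (P.image (single_natCast_nonneg i 0) C.U).map (Submodule.mkQ _) = ⊤
  rw [this, Submodule.map_top, Submodule.range_mkQ]

lemma image_single_self :
    P.image (single_natCast_nonneg i (r i)) C.U = C.ideal i • ⊤ := by
  have h := P.image_shift (indicator_nonneg {i}) 0 C.U
  rw [divisorIdeal_indicator, Finset.prod_singleton] at h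
  rw [← h]
  -- The two indices are equal but not definitionally so; the inequalities in both directions
  -- compare the images without transporting sections.
  have (j : I) : Pi.single (M := fun _ => ℤ) i (r i : ℤ) j = shift r 0 (indicator {i}) j := by
    by_cases hj : j = i
    · subst hj
      simp [shift, indicator]
    · simp [shift, indicator, hj]
  exact le_antisymm (P.image_anti _ _ (fun j => (this j).ge) C.U)
    (P.image_anti _ _ (fun j => (this j).le) C.U)

lemma componentFiltration_self : P.componentFiltration i C (r i) = ⊥ := by
  rw [componentFiltration, ParabolicBundle.imageIn, ← le_bot_iff, Submodule.map_le_iff_le_comap,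
    ← LinearMap.ker, Submodule.ker_mkQ]
  exact (P.image_single_self i C).le

/-- Strongness is used on `E` at index `m • e_i`, where the residue minus `m / r i` lands in the
image of the next step. The horizontal transition to `E_0` intertwines the residues and carries the
relation over. -/
lemma IsStrong.residue_sub_mem {P : ParabolicConnection k J r} (hP : P.IsStrong) (m : ℕ)
    {x} (hx : x ∈ P.componentFiltration i C m) :
    (P.conn 0).residue i C x - algebraMap k C.ring ((m : ℕ) / (r i : k)) • x ∈
      P.componentFiltration i C (m + 1) := by
  obtain ⟨_, ⟨y, rfl⟩, rfl⟩ := hx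
  have h1 := hP (Pi.single i (m : ℤ)) i C (Submodule.mkQ _ y)
  rw [← map_smul, ← sub_eq_zero, ← map_sub, Submodule.mkQ_apply, Submodule.Quotient.mk_eq_zero,
    Pi.single_eq_same, Int.cast_natCast] at h1
  obtain ⟨_, ⟨z, rfl⟩, hz⟩ := h1
  have h2 := congr(mapQuotSMul (C.ideal i)
    (appLinear (trans P.E (single_natCast_nonneg i m)) C.U.1) $hz)
  rw [map_sub, map_smul] at h2
  have h3 := residue_mapQuotSMul ((P.conn (Pi.single i (m : ℤ))).conn C) ((P.conn 0).conn C)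
    (appLinear (trans P.E (single_natCast_nonneg i m)) C.U.1)
    (P.horizontal (single_natCast_nonneg i m) C) i (Submodule.mkQ _ y)
  -- The section `z` lives at `m • e_i + e_i`; the transition morphism along the equality of indices
  -- moves it to `(m + 1) • e_i`.
  refine ⟨_, ⟨appLinear (trans P.E (b := Pi.single i (m : ℤ) + Pi.single i 1)
    (a := Pi.single i ((m + 1 : ℕ) : ℤ)) (by simp [Pi.single_add])) C.U.1 z, rfl⟩, ?_⟩
  rw [P.trans_trans, ← P.trans_trans (single_natCast_nonneg i m) (le_add_single _ i)]
  exact h2.trans (congrArg₂ (· - ·) h3.symm rfl)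

variable (hdist : Function.Injective (fun m : Fin (r i) => ((m : ℕ) / (r i : k) : k)))

-- Distinct weights differ by a unit of the field `k`, and units of `k` stay units in the ring of
-- sections.
omit [Fintype I] [DecidableEq I] in
include hdist in
lemma isUnit_weight_sub (m : ℕ) (hm : m < r i) (n : ℕ) (hn : n < r i) (h : m ≠ n) :
    IsUnit (algebraMap k C.ring ((m : ℕ) / (r i : k)) -
      algebraMap k C.ring ((n : ℕ) / (r i : k))) := by
  rw [← map_sub]
  refine (IsUnit.mk0 _ (sub_ne_zero.mpr fun e => h ?_)).map _
  exact congrArg Fin.val (@hdist ⟨m, hm⟩ ⟨n, hn⟩ e)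

include hdist in
/-- The filtration of the restriction of `E_0` to `D i` is the one by the eigenvalues of the
residue. -/
theorem IsStrong.componentFiltration_eq {P : ParabolicConnection k J r} (hP : P.IsStrong) {l : ℕ}
    (hl : l ≤ r i) :
    P.componentFiltration i C l =
      ⨆ m ∈ Finset.Ico l (r i), (P.conn 0).eigenSubsheaf i C ((m : ℕ) / (r i : k)) :=
  filtration_eq_iSup_eigenspace ((P.conn 0).residue i C)
    (c := fun m => algebraMap k C.ring ((m : ℕ) / (r i : k)))
    (isUnit_weight_sub i C hdist) (P.componentFiltration_antitone i C)
    (P.componentFiltration_zero i C) (P.componentFiltration_self i C)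
    (fun m _ _ hx => hP.residue_sub_mem i C m hx) hl

theorem IsStrong.hasSemisimpleResidues {P : ParabolicConnection k J r} (hP : P.IsStrong)
    (hdist : ∀ i, Function.Injective (fun m : Fin (r i) => ((m : ℕ) / (r i : k) : k))) :
    (P.conn 0).HasSemisimpleResidues r := fun i C =>
  isInternal_eigenspace ((P.conn 0).residue i C)
    (c := fun m => algebraMap k C.ring ((m : ℕ) / (r i : k)))
    (isUnit_weight_sub i C (hdist i))
    ((hP.componentFiltration_eq i C (hdist i) (Nat.zero_le _)).symm.trans
      (P.componentFiltration_zero i C))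

/-- For `m ≤ r i` the image of `E` at `m • e_i` already contains `E_0(-D_i)`, so nothing is lost in
the quotient. -/
lemma mem_componentFiltration_iff {m : ℕ} (hm : m ≤ r i) (s : Γ(P.E.obj (op 0), C.U.1)) :
    Submodule.mkQ _ s ∈ P.componentFiltration i C m ↔
      s ∈ P.image (single_natCast_nonneg i m) C.U := by
  have hle : C.ideal i • ⊤ ≤ P.image (single_natCast_nonneg i m) C.U := by
    rw [← P.image_single_self]
    exact P.image_anti _ _ (Pi.single_le_single.mpr (by exact_mod_cast hm)) C.U
  change s ∈ ((P.image (single_natCast_nonneg i m) C.U).map (Submodule.mkQ _)).comap _ ↔ _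
  rw [Submodule.comap_map_mkQ, sup_eq_right.mpr hle]

/-- The same on all of `D`: the bound `l ≤ r` makes the image contain `E_0(-D)`, by periodicity
along the all-ones vector. -/
lemma mem_weightFiltration_iff {l : I → ℤ} (hl : 0 ≤ l) (hlr : ∀ i, l i ≤ r i) (U : X.affineOpens)
    (s : Γ(P.E.obj (op 0), U.1)) :
    Submodule.mkQ _ s ∈ P.weightFiltration hl U ↔ s ∈ P.image hl U := by
  have hle : (∏ i, J i).ideal U • ⊤ ≤ P.image hl U := by
    have h := P.image_shift (indicator_nonneg Finset.univ) 0 U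
    rw [divisorIdeal_indicator, ← ideal_prod] at h
    rw [← h]
    exact P.image_anti _ _ (fun j => by simpa [shift, indicator] using hlr j) U
  change s ∈ ((P.image hl U).map (Submodule.mkQ _)).comap _ ↔ _
  rw [Submodule.comap_map_mkQ, sup_eq_right.mpr hle]

theorem IsStrong.weightFiltration_eq {P : ParabolicConnection k J r} (hP : P.IsStrong)
    (hX : IsLogSmooth k X J) (hr : ∀ i, 1 ≤ r i)
    (hdist : ∀ i, Function.Injective (fun m : Fin (r i) => ((m : ℕ) / (r i : k) : k)))
    {l : I → ℤ} (hl : 0 ≤ l) (hlr : ∀ i, l i ≤ r i) :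
    P.weightFiltration hl C.U = (P.conn 0).residueFiltration r l C := by
  choose f hf using fun i => (C.principal i).principal
  lift l to I → ℕ using hl
  have hlr' (i : I) : l i ≤ r i := Int.ofNat_le.mp (hlr i)
  have hcomp (i : I) : (⨆ m : {m : Fin (r i) // (l i : ℤ) ≤ m.1},
      (P.conn 0).eigenSubsheaf i C ((m.1.1 : ℕ) / (r i : k))) = P.componentFiltration i C (l i) := by
    rw [hP.componentFiltration_eq i C (hdist i) (hlr' i)]
    apply le_antisymm
    · exact iSup_le fun m => le_iSup₂_of_le m.1.1
        (Finset.mem_Ico.mpr ⟨by exact_mod_cast m.2, m.1.2⟩) le_rfl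
    · refine iSup₂_le fun m hm => ?_
      rw [Finset.mem_Ico] at hm
      exact le_iSup_of_le ⟨⟨m, hm.2⟩, by exact_mod_cast hm.1⟩ le_rfl
  ext x
  obtain ⟨s, rfl⟩ := Submodule.mkQ_surjective _ x
  -- Both memberships are now lifted to a section `s` of `E_0`, where the claim is that the image of
  -- `E` at `l` is the intersection of the images at the `l i • e_i`.
  rw [mem_weightFiltration_iff P _ hlr, LogConnection.residueFiltration, Submodule.mem_iInf]
  simp only [hcomp, Submodule.mem_comap]
  have (i : I) : toComponent (P.E.obj (op 0)) i C (Submodule.mkQ _ s) = Submodule.mkQ _ s := rfl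
  simp only [this, fun i => P.mem_componentFiltration_iff i C (hlr' i)]
  refine ⟨fun h i => P.image_anti _ _ (fun j => ?_) C.U h, fun h => ?_⟩
  · by_cases hj : j = i
    · subst hj
      simp
    · simp [hj]
  · exact P.mem_image_of_forall_mem hX.cartier hr C.U hf hX.integral hX.distinct _ hlr h

end ParabolicConnection

end ParConn

end

theorem mainTheorem5 {k : Type u} [Field k] {X : Scheme.{u}} [X.Over (Spec (.of k))]
    {I : Type*} [Fintype I] [DecidableEq I] (J : I → X.IdealSheafData)
    (hX : ParConn.IsLogSmooth k X J)
    (r : I → ℕ) (hr : ∀ i, (r i : k) ≠ 0)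
    (hdist : ∀ i, Function.Injective (fun m : Fin (r i) => ((m : ℕ) / (r i : k) : k)))
    (P : ParConn.ParabolicConnection k J r) (hP : P.IsStrong) :
    (P.conn 0).HasSemisimpleResidues r ∧
      ∀ (l : I → ℤ) (hl : 0 ≤ l), (∀ i, l i ≤ r i) → ∀ C : ParConn.LogChart J,
        P.weightFiltration hl C.U = (P.conn 0).residueFiltration r l C := by
  have hr' (i : I) : 1 ≤ r i := Nat.one_le_iff_ne_zero.mpr fun h => hr i (by rw [h, Nat.cast_zero])
  exact ⟨hP.hasSemisimpleResidues hdist, fun l hl hlr C =>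
    hP.weightFiltration_eq C hX hr' hdist hl hlr⟩
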